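/- A partition of $n$ is called super-distinct if any two of its parts differ by at least $2$. Let $n \ge 1$ be an integer, let $A(n)$ be the total number of parts (counted with multiplicity) in all super-distinct partitions of $n$, and let $B(n)$ be the total number of parts equal to $1$ (counted with multiplicity) in all partitions of $n$ into parts congruent to $\pm 1 \pmod 5$. Then $A(n) \le B(n)$, and $A(n) < B(n)$ whenever $n \ge 2$. -/

import Mathlib

/-- A partition is super-distinct if any two of its parts (taken at two different positions)
differ by at least `2`. In particular the empty partition is super-distinct. -/
def IsSuperDistinct {n : ℕ} (p : n.Partition) : Prop :=
  p.parts.Pairwise fun a b => a + 2 ≤ b ∨ b + 2 ≤ a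

/-- All parts of the partition are congruent to `1` or `-1` modulo `5`. -/
def HasPartsPlusMinusOneModFive {n : ℕ} (p : n.Partition) : Prop :=
  ∀ a ∈ p.parts, (a : ℤ) ≡ 1 [ZMOD 5] ∨ (a : ℤ) ≡ -1 [ZMOD 5]

open Classical in
/-- The total number of parts, counted with multiplicity, in all super-distinct partitions
of `n`. -/
noncomputable def numPartsSuperDistinct (n : ℕ) : ℕ :=
  ∑ p : n.Partition with IsSuperDistinct p, p.parts.card

open Classical in
/-- The total number of parts equal to `1`, counted with multiplicity, in all partitions of `n`
into parts congruent to `1` or `-1` modulo `5`. -/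
noncomputable def numOnesPlusMinusOneModFive (n : ℕ) : ℕ :=
  ∑ p : n.Partition with HasPartsPlusMinusOneModFive p, p.parts.count 1

/-!
Let `r k` and `t k` be the numbers of super-distinct partitions of `k` and of partitions of `k` into
parts `±1` modulo `5`. Splitting off ones shows that the right-hand side is `∑ k < n, t k`
(`numOnesPlusMinusOneModFive_eq_sum`). The left-hand side counts pairs of a super-distinct partition
of `n` and one of its parts, and deleting that part maps these pairs to super-distinct partitions of
size less than `n`. The map is injective, because the deleted part is the difference of the sizes,
and for `n ≥ 2` it misses the partition with the single part `n / 2`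
(`sum_card_superDistinctSets_le`). So the left-hand side is at most `∑ k < n, r k`, strictly for
`n ≥ 2`, and everything reduces to the first Rogers–Ramanujan identity `r k = t k`
(`card_superDistinctSets_eq`).

That identity is proved by Schur's method. The generating functions `D n` of super-distinct
partitions with parts at most `n` satisfy `D (n + 2) = D (n + 1) + q ^ (n + 2) * D n`. The same recurrence
holds for the theta series `∑ (-1) ^ j * q ^ (j * (5 * j + 1) / 2)` with its terms weighted by Gaussian
binomials (`eq_thetaSum_of_recurrence`). With other weights the theta series is a finite product
of factors `1 - q ^ (5 * k + 2)` and `1 - q ^ (5 * k + 3)`, a finite Jacobi triple product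
(`thetaSum_finite_jacobi`). In the limit the weights become constant, and the two evaluations of
the theta series can be compared. The limit is taken algebraically: in a ring where `q ^ N = 0`,
such as `ℤ⟦X⟧ / (X ^ N)`, the relevant binomials are equal to their limits
(`qBinom_mul_qPoch_eq_one`).
-/

open Finset

section QSeries

variable {R : Type*} [CommRing R]

/-! ### Gaussian binomial coefficients -/

/-- The Gaussian binomial coefficient with base `q`, defined by the `q`-Pascal recursion. The lower
index is an integer, and the value is `0` when it lies outside `[0, n]`; the truncation in
`k.toNat` is therefore harmless. -/
def qBinom (q : R) : ℕ → ℤ → R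
  | 0, k => if k = 0 then 1 else 0
  | n + 1, k => qBinom q n (k - 1) + q ^ k.toNat * qBinom q n k

theorem qBinom_succ (q : R) (n : ℕ) (k : ℤ) :
    qBinom q (n + 1) k = qBinom q n (k - 1) + q ^ k.toNat * qBinom q n k := rfl

theorem qBinom_of_neg (q : R) (n : ℕ) {k : ℤ} (hk : k < 0) : qBinom q n k = 0 := by
  induction n generalizing k with
  | zero => simp [qBinom, hk.ne]
  | succ n ih => rw [qBinom_succ, ih hk, ih (by omega)]; simp

theorem qBinom_of_lt (q : R) {n : ℕ} {k : ℤ} (hk : n < k) : qBinom q n k = 0 := by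
  induction n generalizing k with
  | zero => simp only [qBinom]; rw [if_neg]; rintro rfl; simp at hk
  | succ n ih =>
    push_cast at hk
    rw [qBinom_succ, ih (by omega), ih (by omega)]; simp

/-- Two monomial multiples of the same Gaussian binomial agree as soon as the total exponents agree
and the exponents are nonnegative wherever the binomial does not vanish. -/
theorem pow_mul_qBinom_congr (q p : R) {n : ℕ} {k a b c d : ℤ}
    (h : 0 ≤ k → k ≤ n → (0 ≤ a ∧ 0 ≤ b) ∧ 0 ≤ c ∧ 0 ≤ d) (habcd : a + b = c + d) :
    q ^ a.toNat * (q ^ b.toNat * qBinom p n k) = q ^ c.toNat * (q ^ d.toNat * qBinom p n k) := by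
  rcases lt_or_ge k 0 with hk | hk
  · simp [qBinom_of_neg p n hk]
  rcases lt_or_ge (n : ℤ) k with hk' | hk'
  · simp [qBinom_of_lt p hk']
  obtain ⟨⟨ha, hb⟩, hc, hd⟩ := h hk hk'
  rw [← mul_assoc, ← mul_assoc, ← pow_add, ← pow_add, ← Int.toNat_add ha hb, ← Int.toNat_add hc hd,
    habcd]

/-- The other `q`-Pascal recursion. -/
theorem qBinom_succ' (q : R) (n : ℕ) (k : ℤ) :
    qBinom q (n + 1) k = q ^ (n + 1 - k).toNat * qBinom q n (k - 1) + qBinom q n k := by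
  induction n generalizing k with
  | zero =>
    simp only [qBinom]
    rcases eq_or_ne k 0 with rfl | h0
    · simp
    rcases eq_or_ne k 1 with rfl | h1
    · simp
    simp [h0, sub_eq_zero, h1]
  | succ n ih =>
    have key : q ^ k.toNat * (q ^ (n + 1 - k).toNat * qBinom q n (k - 1)) =
        q ^ (n + 1 + 1 - k).toNat * (q ^ (k - 1).toNat * qBinom q n (k - 1)) := by
      exact pow_mul_qBinom_congr q q (by omega) (by ring)
    have e : (n : ℤ) + 1 - (k - 1) = n + 1 + 1 - k := by ring
    calc qBinom q (n + 1 + 1) k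
        = qBinom q (n + 1) (k - 1) + q ^ k.toNat * qBinom q (n + 1) k := rfl
      _ = (q ^ (n + 1 - (k - 1)).toNat * qBinom q n (k - 1 - 1) + qBinom q n (k - 1)) +
          q ^ k.toNat * (q ^ (n + 1 - k).toNat * qBinom q n (k - 1) + qBinom q n k) := by
            rw [ih (k - 1), ih k]
      _ = q ^ (n + 1 + 1 - k).toNat *
            (qBinom q n (k - 1 - 1) + q ^ (k - 1).toNat * qBinom q n (k - 1)) +
          (qBinom q n (k - 1) + q ^ k.toNat * qBinom q n k) := by
            rw [e]; linear_combination key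
      _ = _ := by rw [← qBinom_succ, ← qBinom_succ]; push_cast; rfl

/-- The `q`-Pochhammer symbol `(q; q)_n = (1 - q) ⋯ (1 - q ^ n)`. -/
def qPoch (q : R) (n : ℕ) : R := ∏ k ∈ range n, (1 - q ^ (k + 1))

theorem qPoch_succ (q : R) (n : ℕ) : qPoch q (n + 1) = qPoch q n * (1 - q ^ (n + 1)) :=
  prod_range_succ _ _

theorem qBinom_zero_right (q : R) (n : ℕ) : qBinom q n 0 = 1 := by
  induction n with
  | zero => simp [qBinom]
  | succ n ih => rw [qBinom_succ, ih, qBinom_of_neg q n (by omega : (0 : ℤ) - 1 < 0)]; simp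

theorem qBinom_self (q : R) (n : ℕ) : qBinom q n n = 1 := by
  induction n with
  | zero => simp [qBinom]
  | succ n ih => rw [qBinom_succ, qBinom_of_lt q (k := (n + 1 : ℕ)) (by simp)]; simpa using ih

theorem qBinom_mul_qPoch_mul_qPoch (q : R) (a b : ℕ) :
    qBinom q (a + b) a * (qPoch q a * qPoch q b) = qPoch q (a + b) := by
  induction h : a + b generalizing a b with
  | zero =>
    obtain ⟨rfl, rfl⟩ : a = 0 ∧ b = 0 := by omega
    simp [qPoch, qBinom]
  | succ n ih =>
    rcases a with _ | a
    · obtain rfl : b = n + 1 := by omega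
      simp [qBinom_zero_right, qPoch]
    rcases b with _ | b
    · obtain rfl : a = n := by omega
      rw [qBinom_self]; simp [qPoch]
    have h1 := ih a (b + 1) (by omega)
    have h2 := ih (a + 1) b (by omega)
    have hn : n = a + b + 1 := by omega
    have e : ((a + 1 : ℕ) : ℤ) - 1 = a := by push_cast; ring
    rw [qBinom_succ, e, Int.toNat_natCast, qPoch_succ q n]
    rw [qPoch_succ] at h1 h2 ⊢
    rw [qPoch_succ q b] at *
    have hq : q ^ (n + 1) = q ^ (a + 1) * q ^ (b + 1) := by rw [hn]; ring
    linear_combination (1 - q ^ (a + 1)) * h1 + q ^ (a + 1) * (1 - q ^ (b + 1)) * h2 +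
      qPoch q n * hq

theorem finite_support_mul_qBinom (q : R) (n : ℕ) (c : ℤ → R) {f : ℤ → ℤ}
    (hf : Function.Injective f) : (Function.support fun i => c i * qBinom q n (f i)).Finite := by
  refine ((Set.finite_Icc (0 : ℤ) n).preimage hf.injOn).subset fun i hi => ?_
  simp only [Set.mem_preimage, Set.mem_Icc]
  by_contra hcon
  apply hi
  rcases lt_or_ge (f i) 0 with h | h
  · simp [qBinom_of_neg q n h]
  · simp [qBinom_of_lt q (show (n : ℤ) < f i by omega)]

/-! ### Finite theta sums -/

/-- The terms of even index `2 * i` of the theta series `∑ (-1) ^ j * q ^ (j * (5 * j + 1) / 2)`. -/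
def thetaEven (q : R) (i : ℤ) : R := q ^ (i * (10 * i + 1)).toNat

/-- The terms of odd index `2 * i + 1`, without sign, of the theta series
`∑ (-1) ^ j * q ^ (j * (5 * j + 1) / 2)`. -/
def thetaOdd (q : R) (i : ℤ) : R := q ^ ((2 * i + 1) * (5 * i + 3)).toNat

theorem abs_le_thetaEven_exponent (i : ℤ) : |i| ≤ i * (10 * i + 1) := by
  rcases le_or_gt 0 i with h | h
  · rw [abs_of_nonneg h]; nlinarith
  · rw [abs_of_neg h]; nlinarith

theorem abs_le_thetaOdd_exponent (i : ℤ) : |i| ≤ (2 * i + 1) * (5 * i + 3) := by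
  rcases le_or_gt 0 i with h | h
  · rw [abs_of_nonneg h]; nlinarith
  · rw [abs_of_neg h]; nlinarith

theorem thetaEven_exponent_nonneg (i : ℤ) : 0 ≤ i * (10 * i + 1) :=
  (abs_nonneg i).trans (abs_le_thetaEven_exponent i)

theorem thetaOdd_exponent_nonneg (i : ℤ) : 0 ≤ (2 * i + 1) * (5 * i + 3) :=
  (abs_nonneg i).trans (abs_le_thetaOdd_exponent i)

/-- The theta series `∑ (-1) ^ j * q ^ (j * (5 * j + 1) / 2)` with its terms weighted by Gaussian
binomials with base `p` and upper index `n`. The lower indices are `f i` for the term of index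
`2 * i` and `g i` for the term of index `2 * i + 1`. -/
noncomputable def thetaSum (q p : R) (n : ℕ) (f g : ℤ → ℤ) : R :=
  ∑ᶠ i, thetaEven q i * qBinom p n (f i) - ∑ᶠ i, thetaOdd q i * qBinom p n (g i)

/-- If the even and the odd terms of `thetaSum` change, up to a reindexing `e` of the odd ones, by
`r` times the terms of another `thetaSum` plus a common correction, then the sums themselves change
by `r` times that other `thetaSum`. -/
theorem thetaSum_eq_add_mul (q p r : R) {n₁ n₂ n₃ : ℕ} {f₁ g₁ f₂ g₂ f₃ g₃ h : ℤ → ℤ} (w : ℤ → R)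
    (e : ℤ ≃ ℤ) (hf₂ : f₂.Injective) (hg₂ : g₂.Injective)
    (hf₃ : f₃.Injective) (hg₃ : g₃.Injective) (hh : h.Injective)
    (hf : ∀ i, thetaEven q i * qBinom p n₁ (f₁ i) = thetaEven q i * qBinom p n₂ (f₂ i) +
      (r * (thetaEven q i * qBinom p n₃ (f₃ i)) + w i * qBinom p n₃ (h i)))
    (hg : ∀ i, thetaOdd q i * qBinom p n₁ (g₁ i) = thetaOdd q i * qBinom p n₂ (g₂ i) +
      (r * (thetaOdd q i * qBinom p n₃ (g₃ i)) + w (e i) * qBinom p n₃ (h (e i)))) :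
    thetaSum q p n₁ f₁ g₁ = thetaSum q p n₂ f₂ g₂ + r * thetaSum q p n₃ f₃ g₃ := by
  have F₂ := finite_support_mul_qBinom p n₂ (thetaEven q) hf₂
  have G₂ := finite_support_mul_qBinom p n₂ (thetaOdd q) hg₂
  have F₃ := finite_support_mul_qBinom p n₃ (thetaEven q) hf₃
  have G₃ := finite_support_mul_qBinom p n₃ (thetaOdd q) hg₃
  have F₃' := finite_support_mul_qBinom p n₃ (fun i => r * thetaEven q i) hf₃
  have G₃' := finite_support_mul_qBinom p n₃ (fun i => r * thetaOdd q i) hg₃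
  have H := finite_support_mul_qBinom p n₃ w hh
  have H' := finite_support_mul_qBinom p n₃ (fun i => w (e i)) (hh.comp e.injective)
  simp only [Function.comp_apply] at H'
  simp only [mul_assoc] at F₃' G₃'
  have hE := finsum_comp_equiv e (f := fun i => w i * qBinom p n₃ (h i))
  simp only [thetaSum, hf, hg]
  rw [finsum_add_distrib F₂ ((F₃'.union H).subset (Function.support_add _ _)),
    finsum_add_distrib G₂ ((G₃'.union H').subset (Function.support_add _ _)),
    finsum_add_distrib F₃' H, finsum_add_distrib G₃' H', hE,
    ← mul_finsum' (fun i => thetaEven q i * _) r F₃,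
    ← mul_finsum' (fun i => thetaOdd q i * _) r G₃]
  ring

/-- If the even and the odd terms of `thetaSum` change, up to reindexings, by `r` times each other,
then the sum itself is multiplied by `1 - r`. -/
theorem thetaSum_eq_mul_one_sub (q p r : R) {n₁ n₂ : ℕ} {f₁ g₁ f₂ g₂ : ℤ → ℤ}
    (e e' : ℤ ≃ ℤ) (hf₂ : f₂.Injective) (hg₂ : g₂.Injective)
    (hf : ∀ i, thetaEven q i * qBinom p n₁ (f₁ i) = thetaEven q i * qBinom p n₂ (f₂ i) +
      r * (thetaOdd q (e i) * qBinom p n₂ (g₂ (e i))))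
    (hg : ∀ i, thetaOdd q i * qBinom p n₁ (g₁ i) = thetaOdd q i * qBinom p n₂ (g₂ i) +
      r * (thetaEven q (e' i) * qBinom p n₂ (f₂ (e' i)))) :
    thetaSum q p n₁ f₁ g₁ = thetaSum q p n₂ f₂ g₂ * (1 - r) := by
  have F := finite_support_mul_qBinom p n₂ (thetaEven q) hf₂
  have G := finite_support_mul_qBinom p n₂ (thetaOdd q) hg₂
  have F' := finite_support_mul_qBinom p n₂ (fun i => thetaEven q (e' i)) (hf₂.comp e'.injective)
  have G' := finite_support_mul_qBinom p n₂ (fun i => thetaOdd q (e i)) (hg₂.comp e.injective)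
  simp only [Function.comp_apply] at F' G'
  have hE := finsum_comp_equiv e' (f := fun i => thetaEven q i * qBinom p n₂ (f₂ i))
  have hO := finsum_comp_equiv e (f := fun i => thetaOdd q i * qBinom p n₂ (g₂ i))
  simp only [thetaSum, hf, hg]
  rw [finsum_add_distrib F (G'.subset (Function.support_mul_subset_right (fun _ => r) _)),
    finsum_add_distrib G (F'.subset (Function.support_mul_subset_right (fun _ => r) _)),
    ← mul_finsum' (fun i => thetaEven q (e' i) * _) r F',
    ← mul_finsum' (fun i => thetaOdd q (e i) * _) r G', hE, hO]
  ring

/-- Recurrence for Schur's finite form of the Rogers–Ramanujan sum, odd upper index. Each binomial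
on the left is expanded by two `q`-Pascal steps; what remains cancels between the term of index `2 * i`
and the term of index `2 * i + 1`. -/
theorem thetaSum_schur_odd (q : R) (m : ℕ) :
    thetaSum q q (2 * (m + 1) + 1) (fun i => m + 1 - 5 * i) (fun i => m + 1 - 5 * i - 2) =
      thetaSum q q (2 * (m + 1)) (fun i => m + 1 - 5 * i) (fun i => m + 1 - 5 * i - 3) +
      q ^ (2 * m + 2) *
        thetaSum q q (2 * m + 1) (fun i => m - 5 * i) (fun i => m - 5 * i - 2) := by
  refine thetaSum_eq_add_mul q q _ (fun i => thetaEven q i * q ^ (m + 2 + 5 * i).toNat)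
    (h := fun i => m - 5 * i - 1) (Equiv.refl ℤ) ?_ ?_ ?_ ?_ ?_ (fun i => ?_) (fun i => ?_)
  all_goals try (intro x y h; simp only at h; omega)
  · have key := pow_mul_qBinom_congr q q (n := 2 * m + 1) (k := m - 5 * i) (a := m + 2 + 5 * i)
      (b := m - 5 * i) (c := (2 * m + 2 : ℕ)) (d := 0) (by intros; omega) (by push_cast; ring)
    rw [Int.toNat_natCast, Int.toNat_zero, pow_zero, one_mul] at key
    rw [qBinom_succ', show (m + 1 - 5 * i - 1 : ℤ) = m - 5 * i by ring,
      show 2 * (m + 1) = 2 * m + 1 + 1 by ring, qBinom_succ q (2 * m + 1) (m - 5 * i),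
      show ((2 * m + 1 + 1 : ℕ) + 1 - (m + 1 - 5 * i) : ℤ) = m + 2 + 5 * i by push_cast; ring]
    linear_combination thetaEven q i * key
  · have key := pow_mul_qBinom_congr q q (n := 2 * m + 1) (k := m - 5 * i - 2)
      (a := m + 1 - 5 * i - 2) (b := m + 3 + 5 * i) (c := (2 * m + 2 : ℕ)) (d := 0)
      (by intros; omega) (by push_cast; ring)
    rw [Int.toNat_natCast, Int.toNat_zero, pow_zero, one_mul] at key
    have key' := pow_mul_qBinom_congr q q (n := 2 * m + 1) (k := m - 5 * i - 1)
      (a := (2 * i + 1) * (5 * i + 3)) (b := m + 1 - 5 * i - 2) (c := i * (10 * i + 1))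
      (d := m + 2 + 5 * i) (fun _ _ => ⟨⟨thetaOdd_exponent_nonneg i, by omega⟩,
        thetaEven_exponent_nonneg i, by omega⟩) (by ring)
    rw [qBinom_succ, show 2 * (m + 1) = 2 * m + 1 + 1 by ring,
      qBinom_succ' q (2 * m + 1) (m + 1 - 5 * i - 2),
      show (m + 1 - 5 * i - 2 - 1 : ℤ) = m - 5 * i - 2 by ring,
      show (m + 1 - 5 * i - 2 : ℤ) = m - 5 * i - 1 by ring,
      show (m + 1 - 5 * i - 3 : ℤ) = m - 5 * i - 2 by ring,
      show ((2 * m + 1 : ℕ) + 1 - (m - 5 * i - 1) : ℤ) = m + 3 + 5 * i by push_cast; ring]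
    rw [show (m + 1 - 5 * i - 2 : ℤ) = m - 5 * i - 1 by ring] at key key'
    simp only [Equiv.refl_apply, thetaEven, thetaOdd] at key' ⊢
    linear_combination q ^ ((2 * i + 1) * (5 * i + 3)).toNat * key + key'

/-- Recurrence for Schur's finite form of the Rogers–Ramanujan sum, even upper index. Here the
remainders cancel between the term of index `2 * i + 1` and the term of index `2 * i + 2`. -/
theorem thetaSum_schur_even (q : R) (m : ℕ) :
    thetaSum q q (2 * (m + 1)) (fun i => m + 1 - 5 * i) (fun i => m + 1 - 5 * i - 3) =
      thetaSum q q (2 * m + 1) (fun i => m - 5 * i) (fun i => m - 5 * i - 2) +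
      q ^ (2 * m + 1) *
        thetaSum q q (2 * m) (fun i => m - 5 * i) (fun i => m - 5 * i - 3) := by
  refine thetaSum_eq_add_mul q q _ (fun i => thetaEven q i * q ^ (m + 1 - 5 * i).toNat)
    (h := fun i => m + 1 - 5 * i) (Equiv.addRight (1 : ℤ)) ?_ ?_ ?_ ?_ ?_ (fun i => ?_)
    (fun i => ?_)
  all_goals try (intro x y h; simp only at h; omega)
  · have key := pow_mul_qBinom_congr q q (n := 2 * m) (k := m - 5 * i) (a := m + 1 - 5 * i)
      (b := m + 5 * i) (c := (2 * m + 1 : ℕ)) (d := 0) (by intros; omega) (by push_cast; ring)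
    rw [Int.toNat_natCast, Int.toNat_zero, pow_zero, one_mul] at key
    rw [show 2 * (m + 1) = 2 * m + 1 + 1 by ring, qBinom_succ,
      show (m + 1 - 5 * i - 1 : ℤ) = m - 5 * i by ring, qBinom_succ' q (2 * m) (m + 1 - 5 * i),
      show (m + 1 - 5 * i - 1 : ℤ) = m - 5 * i by ring,
      show ((2 * m : ℕ) + 1 - (m + 1 - 5 * i) : ℤ) = m + 5 * i by push_cast; ring]
    linear_combination thetaEven q i * key
  · have key := pow_mul_qBinom_congr q q (n := 2 * m) (k := m - 5 * i - 3)
      (a := m + 4 + 5 * i) (b := m - 5 * i - 3) (c := (2 * m + 1 : ℕ)) (d := 0)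
      (by intros; omega) (by push_cast; ring)
    rw [Int.toNat_natCast, Int.toNat_zero, pow_zero, one_mul] at key
    have key' := pow_mul_qBinom_congr q q (n := 2 * m) (k := m - 5 * i - 4)
      (a := (2 * i + 1) * (5 * i + 3)) (b := m + 4 + 5 * i) (c := (i + 1) * (10 * (i + 1) + 1))
      (d := m + 1 - 5 * (i + 1)) (fun _ _ => ⟨⟨thetaOdd_exponent_nonneg i, by omega⟩,
        thetaEven_exponent_nonneg (i + 1), by omega⟩) (by ring)
    rw [show 2 * (m + 1) = 2 * m + 1 + 1 by ring, qBinom_succ',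
      show (m + 1 - 5 * i - 3 : ℤ) = m - 5 * i - 2 by ring,
      show (m - 5 * i - 2 - 1 : ℤ) = m - 5 * i - 3 by ring,
      qBinom_succ q (2 * m) (m - 5 * i - 3),
      show (m - 5 * i - 3 - 1 : ℤ) = m - 5 * i - 4 by ring,
      show ((2 * m + 1 : ℕ) + 1 - (m - 5 * i - 2) : ℤ) = m + 4 + 5 * i by push_cast; ring]
    simp only [Equiv.coe_addRight, thetaEven, thetaOdd] at key' ⊢
    rw [show (m + 1 - 5 * (i + 1) : ℤ) = m - 5 * i - 4 by ring] at key' ⊢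
    linear_combination q ^ ((2 * i + 1) * (5 * i + 3)).toNat * key + key'

theorem thetaSum_zero (q p : R) {f g : ℤ → ℤ} {i₀ : ℤ} (hf : ∀ i, f i = 0 ↔ i = i₀)
    (hg : ∀ i, g i ≠ 0) : thetaSum q p 0 f g = thetaEven q i₀ := by
  simp only [thetaSum, qBinom, hf, hg]
  simp only [mul_ite, mul_one, mul_zero, if_false, finsum_zero, sub_zero]
  rw [finsum_eq_single _ i₀ (fun i hi => if_neg hi), if_pos rfl]

/-- Finite form of the Jacobi triple product, specialized to
`∏ (1 - q ^ (5 * k + 2)) * (1 - q ^ (5 * k + 3))`. -/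
theorem thetaSum_finite_jacobi (q : R) (a b : ℕ) :
    thetaSum q (q ^ 5) (a + b) (fun i => a + 2 * i) (fun i => a + 2 * i + 1) =
      (∏ k ∈ range a, (1 - q ^ (5 * k + 2))) * ∏ k ∈ range b, (1 - q ^ (5 * k + 3)) := by
  induction a with
  | zero =>
    induction b with
    | zero =>
      rw [thetaSum_zero (i₀ := 0)]
      · simp [thetaEven]
      · intro i; simp
      · intro i; simp only [Nat.cast_zero]; omega
    | succ b ih =>
      rw [prod_range_succ, ← mul_assoc, ← ih]
      refine thetaSum_eq_mul_one_sub q (q ^ 5) _ (Equiv.subRight (1 : ℤ)) (Equiv.refl ℤ) ?_ ?_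
        (fun i => ?_) (fun i => ?_)
      · intro x y h; simp only at h; omega
      · intro x y h; simp only at h; omega
      · have key := pow_mul_qBinom_congr q (q ^ 5) (n := b) (k := 2 * i - 1)
          (a := i * (10 * i + 1)) (b := 5 * (b + 1 - 2 * i)) (c := (5 * b + 3 : ℕ))
          (d := (2 * (i - 1) + 1) * (5 * (i - 1) + 3)) (fun _ _ => ⟨⟨thetaEven_exponent_nonneg i,
            by omega⟩, by omega, thetaOdd_exponent_nonneg (i - 1)⟩) (by push_cast; ring)
        rw [Int.toNat_natCast] at key
        simp only [zero_add, Nat.cast_zero, thetaEven, thetaOdd, Equiv.subRight_apply] at key ⊢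
        rw [qBinom_succ', ← pow_mul,
          show 5 * ((b : ℤ) + 1 - 2 * i).toNat = (5 * ((b : ℤ) + 1 - 2 * i)).toNat by omega,
          show 2 * (i - 1) + 1 = 2 * i - 1 by ring] at *
        linear_combination key
      · have key := pow_mul_qBinom_congr q (q ^ 5) (n := b) (k := 2 * i)
          (a := (2 * i + 1) * (5 * i + 3)) (b := 5 * (b - 2 * i)) (c := (5 * b + 3 : ℕ))
          (d := i * (10 * i + 1)) (fun _ _ => ⟨⟨thetaOdd_exponent_nonneg i,
            by omega⟩, by omega, thetaEven_exponent_nonneg i⟩) (by push_cast; ring)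
        rw [Int.toNat_natCast] at key
        simp only [zero_add, Nat.cast_zero, thetaEven, thetaOdd, Equiv.refl_apply] at key ⊢
        rw [qBinom_succ', ← pow_mul,
          show 5 * ((b : ℤ) + 1 - (2 * i + 1)).toNat = (5 * ((b : ℤ) - 2 * i)).toNat by omega,
          show 2 * i + 1 - 1 = 2 * i by ring]
        linear_combination key
  | succ a ih =>
    rw [prod_range_succ, mul_right_comm, ← ih]
    refine thetaSum_eq_mul_one_sub q (q ^ 5) _ (Equiv.refl ℤ) (Equiv.addRight (1 : ℤ)) ?_ ?_
      (fun i => ?_) (fun i => ?_)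
    · intro x y h; simp only at h; omega
    · intro x y h; simp only at h; omega
    · have key := pow_mul_qBinom_congr q (q ^ 5) (n := a + b) (k := a + 2 * i + 1)
        (a := i * (10 * i + 1)) (b := 5 * (a + 2 * i + 1)) (c := (5 * a + 2 : ℕ))
        (d := (2 * i + 1) * (5 * i + 3)) (fun _ _ => ⟨⟨thetaEven_exponent_nonneg i,
          by omega⟩, by omega, thetaOdd_exponent_nonneg i⟩) (by push_cast; ring)
      rw [Int.toNat_natCast] at key
      simp only [thetaEven, thetaOdd, Equiv.refl_apply] at key ⊢
      rw [show a + 1 + b = a + b + 1 by ring, qBinom_succ, ← pow_mul,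
        show 5 * (((a + 1 : ℕ) : ℤ) + 2 * i).toNat = (5 * ((a : ℤ) + 2 * i + 1)).toNat by omega,
        show ((a + 1 : ℕ) : ℤ) + 2 * i - 1 = a + 2 * i by push_cast; ring,
        show ((a + 1 : ℕ) : ℤ) + 2 * i = a + 2 * i + 1 by push_cast; ring]
      linear_combination key
    · have key := pow_mul_qBinom_congr q (q ^ 5) (n := a + b) (k := a + 2 * (i + 1))
        (a := (2 * i + 1) * (5 * i + 3)) (b := 5 * (a + 2 * (i + 1))) (c := (5 * a + 2 : ℕ))
        (d := (i + 1) * (10 * (i + 1) + 1)) (fun _ _ => ⟨⟨thetaOdd_exponent_nonneg i,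
          by omega⟩, by omega, thetaEven_exponent_nonneg (i + 1)⟩) (by push_cast; ring)
      rw [Int.toNat_natCast] at key
      simp only [thetaEven, thetaOdd, Equiv.coe_addRight] at key ⊢
      rw [show a + 1 + b = a + b + 1 by ring, qBinom_succ, ← pow_mul,
        show 5 * (((a + 1 : ℕ) : ℤ) + 2 * i + 1).toNat = (5 * ((a : ℤ) + 2 * (i + 1))).toNat by
          omega,
        show ((a + 1 : ℕ) : ℤ) + 2 * i + 1 - 1 = a + 2 * i + 1 by push_cast; ring,
        show ((a + 1 : ℕ) : ℤ) + 2 * i + 1 = a + 2 * (i + 1) by push_cast; ring]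
      linear_combination key

/-! ### The limit, modulo a power of the base -/

theorem qPoch_eq_of_pow_eq_zero {q : R} {N n : ℕ} (hq : q ^ N = 0) (h : N ≤ n) :
    qPoch q n = qPoch q N := by
  induction n, h using Nat.le_induction with
  | base => rfl
  | succ n hn ih => rw [qPoch_succ, ih, pow_eq_zero_of_le (by omega) hq, sub_zero, mul_one]

theorem isUnit_one_sub_pow_succ {q : R} {N : ℕ} (hq : q ^ N = 0) (k : ℕ) :
    IsUnit (1 - q ^ (k + 1)) :=
  IsNilpotent.isUnit_one_sub ((show IsNilpotent q from ⟨N, hq⟩).pow_of_pos k.succ_ne_zero)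

theorem isUnit_qPoch {q : R} {N : ℕ} (hq : q ^ N = 0) (n : ℕ) : IsUnit (qPoch q n) :=
  IsUnit.prod_iff.2 fun k _ => isUnit_one_sub_pow_succ hq k

/-- Central Gaussian binomials converge to `1 / ((1 - q) * (1 - q ^ 2) * ⋯)`. -/
theorem qBinom_mul_qPoch_eq_one {q : R} {N n : ℕ} {k : ℤ} (hq : q ^ N = 0) (hk : N ≤ k)
    (hkn : k + N ≤ n) : qBinom q n k * qPoch q N = 1 := by
  lift k to ℕ using by omega
  obtain ⟨b, rfl⟩ : ∃ b, n = k + b := ⟨n - k, by omega⟩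
  have h := qBinom_mul_qPoch_mul_qPoch q k b
  rw [qPoch_eq_of_pow_eq_zero hq (n := k) (by omega),
    qPoch_eq_of_pow_eq_zero hq (n := b) (by omega),
    qPoch_eq_of_pow_eq_zero hq (n := k + b) (by omega), ← mul_assoc] at h
  exact (isUnit_qPoch hq N).mul_right_cancel (h.trans (one_mul _).symm)

/-- A `thetaSum` whose binomials are all central, up to the precision given by `q ^ N = 0`, is the
theta series divided by the infinite `q`-Pochhammer symbol. -/
theorem thetaSum_mul_qPoch {q p : R} {N n : ℕ} {f g : ℤ → ℤ} (hq : q ^ N = 0) (hp : p ^ N = 0)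
    (hf : f.Injective) (hg : g.Injective) (hfN : ∀ i : ℤ, |i| < N → N ≤ f i ∧ f i + N ≤ n)
    (hgN : ∀ i : ℤ, |i| < N → N ≤ g i ∧ g i + N ≤ n) :
    thetaSum q p n f g * qPoch p N = ∑ᶠ i, thetaEven q i - ∑ᶠ i, thetaOdd q i := by
  rw [thetaSum, sub_mul, finsum_mul' _ _ (finite_support_mul_qBinom p n _ hf),
    finsum_mul' _ _ (finite_support_mul_qBinom p n _ hg)]
  congr 1 <;> refine finsum_congr fun i => ?_
  · rcases lt_or_ge |i| N with h | h
    · rw [mul_assoc, qBinom_mul_qPoch_eq_one hp (hfN i h).1 (hfN i h).2, mul_one]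
    · have := abs_le_thetaEven_exponent i
      rw [thetaEven, pow_eq_zero_of_le (by omega) hq, zero_mul, zero_mul]
  · rcases lt_or_ge |i| N with h | h
    · rw [mul_assoc, qBinom_mul_qPoch_eq_one hp (hgN i h).1 (hgN i h).2, mul_one]
    · have := abs_le_thetaOdd_exponent i
      rw [thetaOdd, pow_eq_zero_of_le (by omega) hq, zero_mul, zero_mul]

/-- Schur's finite form of the Rogers–Ramanujan sum: the recurrence
`D (n + 2) = D (n + 1) + q ^ (n + 2) * D n` is solved by a theta sum with binomial weights. -/
theorem eq_thetaSum_of_recurrence {q : R} {D : ℕ → R} (h0 : D 0 = 1) (h1 : D 1 = 1 + q)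
    (h2 : ∀ n, D (n + 2) = D (n + 1) + q ^ (n + 2) * D n) (m : ℕ) :
    D (2 * m) = thetaSum q q (2 * m + 1) (fun i => m - 5 * i) (fun i => m - 5 * i - 2) ∧
    D (2 * m + 1) =
      thetaSum q q (2 * (m + 1)) (fun i => m + 1 - 5 * i) (fun i => m + 1 - 5 * i - 3) := by
  induction m with
  | zero =>
    have e0 : thetaSum q q 0 (fun i => (0 : ℕ) - 5 * i) (fun i => (0 : ℕ) - 5 * i - 3) = 1 := by
      rw [thetaSum_zero (i₀ := 0)]
      · simp [thetaEven]
      · intro i; simp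
      · intro i; simp only [Nat.cast_zero]; omega
    have e1 : thetaSum q q 1 (fun i => (0 : ℕ) - 5 * i) (fun i => (0 : ℕ) - 5 * i - 2) = 1 := by
      have hB : ∀ k, qBinom q 1 k = if k = 0 ∨ k = 1 then 1 else 0 := fun k => by
        rcases eq_or_ne k 0 with rfl | h0
        · simp [qBinom]
        rcases eq_or_ne k 1 with rfl | h1
        · simp [qBinom]
        · simp [qBinom, h0, h1, sub_eq_zero]
      have hg : ∀ i : ℤ, ¬(((0 : ℕ) - 5 * i - 2 : ℤ) = 0 ∨ ((0 : ℕ) - 5 * i - 2 : ℤ) = 1) := by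
        intro i; omega
      have hf : ∀ i : ℤ, (((0 : ℕ) - 5 * i : ℤ) = 0 ∨ ((0 : ℕ) - 5 * i : ℤ) = 1) ↔ i = 0 := by
        intro i; omega
      simp only [thetaSum, hB, hf, hg, if_false, mul_zero, finsum_zero, sub_zero, mul_ite, mul_one]
      rw [finsum_eq_single _ 0 (fun i hi => if_neg hi)]
      simp [thetaEven]
    refine ⟨h0.trans e1.symm, ?_⟩
    have := thetaSum_schur_even q 0
    simp only [mul_zero, zero_add] at this e0 e1 ⊢
    rw [h1, this, e0, e1]; simp
  | succ m ih =>
    have ho := thetaSum_schur_odd q m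
    have he := thetaSum_schur_even q (m + 1)
    have h3 : D (2 * (m + 1)) = thetaSum q q (2 * (m + 1) + 1) (fun i => (m + 1 : ℕ) - 5 * i)
        (fun i => (m + 1 : ℕ) - 5 * i - 2) := by
      rw [show 2 * (m + 1) = 2 * m + 2 by ring, h2, ih.1, ih.2]
      push_cast
      exact ho.symm
    refine ⟨h3, ?_⟩
    rw [he, ← h3, show 2 * (m + 1) + 1 = 2 * m + 1 + 2 by ring, h2, ih.2]
    push_cast
    rfl

theorem qPoch_five_mul (q : R) (M : ℕ) : qPoch q (5 * M) =
    (∏ k ∈ range M, (1 - q ^ (5 * k + 1)) * (1 - q ^ (5 * k + 4))) *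
      ((∏ k ∈ range M, (1 - q ^ (5 * k + 2))) * (∏ k ∈ range M, (1 - q ^ (5 * k + 3))) *
        qPoch (q ^ 5) M) := by
  induction M with
  | zero => simp [qPoch]
  | succ M ih =>
    rw [show 5 * (M + 1) = 5 * M + 1 + 1 + 1 + 1 + 1 by ring]
    simp only [qPoch_succ, prod_range_succ, ih]
    rw [← pow_mul]
    ring

/-- The first Rogers–Ramanujan identity modulo `q ^ N`, with the sum side replaced by a sequence
satisfying the recurrence of the generating functions of super-distinct partitions with bounded
parts. -/
theorem rogersRamanujan_of_recurrence {q : R} {N : ℕ} (hq : q ^ N = 0) {D : ℕ → R} (h0 : D 0 = 1)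
    (h1 : D 1 = 1 + q) (h2 : ∀ n, D (n + 2) = D (n + 1) + q ^ (n + 2) * D n) :
    D (20 * N) * ∏ k ∈ range (10 * N), (1 - q ^ (5 * k + 1)) * (1 - q ^ (5 * k + 4)) = 1 := by
  have hq5 : (q ^ 5) ^ N = 0 := by rw [← pow_mul]; exact pow_eq_zero_of_le (by omega) hq
  -- The size `10 * N` makes all binomials central that belong to terms with `|i| < N`.
  have hS := (eq_thetaSum_of_recurrence h0 h1 h2 (10 * N)).1
  rw [show 2 * (10 * N) = 20 * N by ring] at hS
  have hSlim := thetaSum_mul_qPoch (n := 20 * N + 1) (f := fun i => (10 * N : ℕ) - 5 * i)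
    (g := fun i => (10 * N : ℕ) - 5 * i - 2) hq hq (fun x y h => by simp only at h; omega)
    (fun x y h => by simp only at h; omega)
    (fun i hi => by rw [abs_lt] at hi; push_cast; omega)
    (fun i hi => by rw [abs_lt] at hi; push_cast; omega)
  rw [← hS] at hSlim
  have hJlim := thetaSum_mul_qPoch (n := 10 * N + 10 * N) (f := fun i => (10 * N : ℕ) + 2 * i)
    (g := fun i => (10 * N : ℕ) + 2 * i + 1) hq hq5 (fun x y h => by simp only at h; omega)
    (fun x y h => by simp only at h; omega)
    (fun i hi => by rw [abs_lt] at hi; push_cast; omega)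
    (fun i hi => by rw [abs_lt] at hi; push_cast; omega)
  rw [thetaSum_finite_jacobi, ← hSlim, ← qPoch_eq_of_pow_eq_zero hq5 (n := 10 * N) (by omega),
    ← qPoch_eq_of_pow_eq_zero hq (n := 5 * (10 * N)) (by omega), qPoch_five_mul] at hJlim
  have hu := isUnit_qPoch hq (5 * (10 * N))
  rw [qPoch_five_mul] at hu
  refine (isUnit_of_mul_isUnit_right hu).mul_right_cancel ?_
  rw [one_mul, mul_assoc, ← hJlim]

end QSeries

/-! ### Super-distinct partitions as sets -/

theorem list_pairwise_add_two_le_iff (l : List ℕ) :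
    (l.Pairwise fun a b => a + 2 ≤ b ∨ b + 2 ≤ a) ↔ l.Nodup ∧ ∀ a ∈ l, a + 1 ∉ l := by
  induction l with
  | nil => simp
  | cons x l ih =>
    rw [List.pairwise_cons, ih, List.nodup_cons]
    constructor
    · rintro ⟨h1, h2, h3⟩
      refine ⟨⟨fun h => by have := h1 x h; omega, h2⟩, fun a ha hb => ?_⟩
      rw [List.mem_cons] at ha hb
      rcases ha with rfl | ha <;> rcases hb with hb | hb
      · omega
      · have := h1 _ hb; omega
      · subst hb; have := h1 _ ha; omega
      · exact h3 a ha hb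
    · rintro ⟨⟨h1, h2⟩, h3⟩
      refine ⟨fun a ha => ?_, h2, fun a ha hb => h3 a (by simp [ha]) (by simp [hb])⟩
      have e1 : a ≠ x := fun h => h1 (h ▸ ha)
      have e2 : a ≠ x + 1 := fun h => h3 x (by simp) (by simp [← h, ha])
      have e3 : a + 1 ≠ x := fun h => h3 a (by simp [ha]) (by simp [h])
      omega

theorem pairwise_add_two_le_iff (S : Multiset ℕ) :
    (S.Pairwise fun a b => a + 2 ≤ b ∨ b + 2 ≤ a) ↔ S.Nodup ∧ ∀ a ∈ S, a + 1 ∉ S := by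
  have : Std.Symm fun a b : ℕ => a + 2 ≤ b ∨ b + 2 ≤ a := ⟨fun _ _ h => h.symm⟩
  induction S using Quotient.inductionOn with | _ l => ?_
  exact Multiset.pairwise_coe_iff_pairwise.trans (list_pairwise_add_two_le_iff l)

/-- The sets of positive integers at most `n` without two consecutive elements. They encode the
super-distinct partitions, of any size, with parts at most `n`. -/
def superDistinctSets (n : ℕ) : Finset (Finset ℕ) :=
  (Icc 1 n).powerset.filter fun s => ∀ a ∈ s, a + 1 ∉ s

theorem mem_superDistinctSets {n : ℕ} {s : Finset ℕ} :
    s ∈ superDistinctSets n ↔ (∀ a ∈ s, 1 ≤ a ∧ a ≤ n) ∧ ∀ a ∈ s, a + 1 ∉ s := by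
  simp [superDistinctSets, subset_iff]

theorem numPartsSuperDistinct_eq {m n : ℕ} (h : m ≤ n) :
    numPartsSuperDistinct m = ∑ s ∈ superDistinctSets n with ∑ a ∈ s, a = m, #s := by
  classical
  unfold numPartsSuperDistinct
  refine sum_bij' (fun p _ => p.parts.toFinset)
    (fun s hs => ⟨s.val, fun {i} hi => ((mem_superDistinctSets.1 (mem_filter.1 hs).1).1 i hi).1, by
      rw [← (mem_filter.1 hs).2, Finset.sum, Multiset.map_id']⟩) ?_ ?_ ?_ ?_ ?_
  · intro p hp
    have hp := (pairwise_add_two_le_iff _).1 (mem_filter.1 hp).2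
    rw [mem_filter, mem_superDistinctSets]
    refine ⟨⟨fun a ha => ?_, fun a ha hb => ?_⟩, ?_⟩
    · rw [Multiset.mem_toFinset] at ha
      exact ⟨p.parts_pos ha, (p.le_of_mem_parts ha).trans h⟩
    · exact hp.2 a (by simpa using ha) (by simpa using hb)
    · rw [Finset.sum, Multiset.map_id', Multiset.toFinset_val, hp.1.dedup, p.parts_sum]
  · intro s hs
    rw [mem_filter]
    exact ⟨mem_univ _, (pairwise_add_two_le_iff _).2
      ⟨s.nodup, (mem_superDistinctSets.1 (mem_filter.1 hs).1).2⟩⟩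
  · intro p hp
    have hp := (pairwise_add_two_le_iff _).1 (mem_filter.1 hp).2
    ext1
    simp [hp.1.dedup]
  · intro s hs
    simp
  · intro p hp
    have hp := (pairwise_add_two_le_iff _).1 (mem_filter.1 hp).2
    rw [card_def, Multiset.toFinset_val, hp.1.dedup]

theorem superDistinctSets_add_two (n : ℕ) : superDistinctSets (n + 2) =
    superDistinctSets (n + 1) ∪ (superDistinctSets n).image (insert (n + 2)) := by
  ext s
  simp only [mem_union, mem_image, mem_superDistinctSets]
  constructor
  · rintro ⟨h1, h2⟩
    by_cases hs : n + 2 ∈ s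
    · right
      refine ⟨s.erase (n + 2), ⟨fun a ha => ?_, fun a ha hb => ?_⟩, insert_erase hs⟩
      · rw [mem_erase] at ha
        have := h1 a ha.2
        have : a ≠ n + 1 := by rintro rfl; exact h2 _ ha.2 hs
        omega
      · exact h2 a (mem_of_mem_erase ha) (mem_of_mem_erase hb)
    · left
      refine ⟨fun a ha => ?_, h2⟩
      have := h1 a ha
      have : a ≠ n + 2 := by rintro rfl; exact hs ha
      omega
  · rintro (⟨h1, h2⟩ | ⟨t, ⟨h1, h2⟩, rfl⟩)
    · exact ⟨fun a ha => by have := h1 a ha; omega, h2⟩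
    · refine ⟨fun a ha => ?_, fun a ha hb => ?_⟩
      · rcases mem_insert.1 ha with rfl | ha
        · omega
        · have := h1 a ha; omega
      · rcases mem_insert.1 ha with rfl | ha <;> rcases mem_insert.1 hb with hb | hb
        · omega
        · have := h1 _ hb; omega
        · have := h1 _ ha; omega
        · exact h2 a ha hb

/-- The generating function of super-distinct partitions with parts at most `n`. -/
def superDistinctGenFun {R : Type*} [CommRing R] (q : R) (n : ℕ) : R :=
  ∑ s ∈ superDistinctSets n, q ^ ∑ a ∈ s, a

section
variable {R : Type*} [CommRing R] (q : R)

theorem superDistinctGenFun_zero : superDistinctGenFun q 0 = 1 := by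
  have : superDistinctSets 0 = {∅} := by decide
  simp [superDistinctGenFun, this]

theorem superDistinctGenFun_one : superDistinctGenFun q 1 = 1 + q := by
  have : superDistinctSets 1 = {∅, {1}} := by decide
  simp [superDistinctGenFun, this]

/-- The two summands count the sets without and with the element `n + 2`. -/
theorem superDistinctGenFun_add_two (n : ℕ) : superDistinctGenFun q (n + 2) =
    superDistinctGenFun q (n + 1) + q ^ (n + 2) * superDistinctGenFun q n := by
  have hn : ∀ s ∈ superDistinctSets n, n + 2 ∉ s := fun s hs h => by
    have := (mem_superDistinctSets.1 hs).1 _ h; omega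
  rw [superDistinctGenFun, superDistinctSets_add_two, sum_union, sum_image, superDistinctGenFun,
    superDistinctGenFun, mul_sum]
  · congr 1
    refine sum_congr rfl fun s hs => ?_
    rw [sum_insert (hn s hs), pow_add]
  · intro s hs t ht h
    rw [← erase_insert (hn s hs), ← erase_insert (hn t ht), h]
  · rw [disjoint_left]
    intro s hs hs'
    obtain ⟨t, -, rfl⟩ := mem_image.1 hs'
    have := (mem_superDistinctSets.1 hs).1 (n + 2) (mem_insert_self _ _)
    omega

end

/-! ### Partitions into parts congruent to `±1` modulo `5` -/

open Classical in
/-- The number of partitions of `n` into parts congruent to `±1` modulo `5`. -/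
noncomputable def numPlusMinusOneModFive (n : ℕ) : ℕ :=
  #{p : n.Partition | HasPartsPlusMinusOneModFive p}

theorem numOnesPlusMinusOneModFive_succ (n : ℕ) : numOnesPlusMinusOneModFive (n + 1) =
    numOnesPlusMinusOneModFive n + numPlusMinusOneModFive n := by
  classical
  unfold numOnesPlusMinusOneModFive numPlusMinusOneModFive
  rw [card_eq_sum_ones, ← sum_add_distrib]
  symm
  refine sum_of_injOn (fun p : n.Partition => (⟨1 ::ₘ p.parts, fun {i} hi => by
      rcases Multiset.mem_cons.1 hi with rfl | h
      exacts [one_pos, p.parts_pos h], by rw [Multiset.sum_cons, p.parts_sum, add_comm]⟩ :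
    (n + 1).Partition)) ?_ ?_ ?_ ?_
  · intro p _ p' _ h
    have := congrArg Nat.Partition.parts h
    ext1
    simpa using this
  · intro p hp
    simp only [coe_filter, mem_univ, true_and, Set.mem_ofPred_eq] at hp ⊢
    intro a ha
    rcases Multiset.mem_cons.1 ha with rfl | h
    exacts [Or.inl rfl, hp a h]
  · intro p hp hp'
    rw [Multiset.count_eq_zero]
    intro h1
    apply hp'
    refine ⟨⟨p.parts.erase 1, fun {i} hi => p.parts_pos (Multiset.mem_of_mem_erase hi), ?_⟩, ?_, ?_⟩
    · have := Multiset.sum_erase h1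
      have := p.parts_sum
      omega
    · simp only [coe_filter, mem_univ, true_and, Set.mem_ofPred_eq]
      intro a ha
      exact (mem_filter.1 hp).2 a (Multiset.mem_of_mem_erase ha)
    · ext1
      exact Multiset.cons_erase h1
  · intro p _
    simp

theorem numOnesPlusMinusOneModFive_eq_sum (n : ℕ) :
    numOnesPlusMinusOneModFive n = ∑ k ∈ range n, numPlusMinusOneModFive k := by
  induction n with
  | zero => simp [numOnesPlusMinusOneModFive]
  | succ n ih => rw [sum_range_succ, numOnesPlusMinusOneModFive_succ, ih]

theorem prod_range_five_mul_ite {R : Type*} [CommMonoid R] (f : ℕ → R) (M : ℕ) :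
    ∏ i ∈ range (5 * M), (if (i + 1) % 5 = 1 ∨ (i + 1) % 5 = 4 then f (i + 1) else 1) =
      ∏ k ∈ range M, f (5 * k + 1) * f (5 * k + 4) := by
  induction M with
  | zero => simp
  | succ M ih =>
    rw [show 5 * (M + 1) = 5 * M + 1 + 1 + 1 + 1 + 1 by ring]
    simp only [prod_range_succ, ih]
    rw [if_pos (by omega), if_neg (by omega), if_neg (by omega), if_pos (by omega),
      if_neg (by omega)]
    simp only [mul_one, mul_assoc]

open scoped PowerSeries.WithPiTopology in
open PowerSeries in
/-- The generating function of the partitions into parts congruent to `±1` modulo `5` and at most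
`5 * M`. Bounding the parts makes the product finite, so that the identity is exact. -/
theorem exists_mul_prod_eq_one (M : ℕ) : ∃ P : ℤ⟦X⟧,
    (∀ n ≤ 5 * M, P.coeff n = numPlusMinusOneModFive n) ∧
    P * ∏ k ∈ range M, (1 - X ^ (5 * k + 1)) * (1 - X ^ (5 * k + 4)) = 1 := by
  classical
  let _ : TopologicalSpace ℤ := ⊥
  have _ : DiscreteTopology ℤ := ⟨rfl⟩
  let p : ℕ → Prop := fun i => (i % 5 = 1 ∨ i % 5 = 4) ∧ i ≤ 5 * M
  have hP := Nat.Partition.powerSeriesMk_card_restricted_eq_tprod ℤ p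
  refine ⟨PowerSeries.mk fun n ↦ (#(Nat.Partition.restricted n p) : ℤ), fun n hn => ?_, ?_⟩
  · rw [coeff_mk, numPlusMinusOneModFive, Nat.Partition.restricted]
    norm_cast
    congr 1
    refine filter_congr fun x _ => forall₂_congr fun a ha => ?_
    have := x.le_of_mem_parts ha
    simp only [p, Int.ModEq]
    omega
  · rw [hP, tprod_eq_prod (s := range (5 * M)),
      ← prod_range_five_mul_ite (fun i => 1 - (X : ℤ⟦X⟧) ^ i), ← prod_mul_distrib]
    · refine prod_eq_one fun i hi => ?_
      rw [mem_range] at hi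
      by_cases h : (i + 1) % 5 = 1 ∨ (i + 1) % 5 = 4
      · rw [if_pos h, if_pos ⟨h, hi⟩]
        simp_rw [pow_mul]
        exact WithPiTopology.tsum_pow_mul_one_sub_of_constantCoeff_eq_zero (by simp)
      · rw [if_neg h, if_neg fun h' => h h'.1, one_mul]
    · intro i hi
      rw [mem_range] at hi
      exact if_neg fun h' => by have := h'.2; omega

/-! ### The first Rogers–Ramanujan identity -/

open PowerSeries in
/-- The first Rogers–Ramanujan identity: super-distinct partitions of `m` are equinumerous with
partitions of `m` into parts congruent to `±1` modulo `5`. -/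
theorem card_superDistinctSets_eq {m N : ℕ} (h : m < N) :
    #{s ∈ superDistinctSets (20 * N) | ∑ a ∈ s, a = m} = numPlusMinusOneModFive m := by
  obtain ⟨P, hP, hP1⟩ := exists_mul_prod_eq_one (10 * N)
  let I : Ideal ℤ⟦X⟧ := Ideal.span {X ^ N}
  let φ := Ideal.Quotient.mk I
  have hX : φ X ^ N = 0 := by
    rw [← map_pow]
    exact Ideal.Quotient.eq_zero_iff_mem.2 (Ideal.subset_span rfl)
  have hD := rogersRamanujan_of_recurrence hX (superDistinctGenFun_zero _)
    (superDistinctGenFun_one _) (superDistinctGenFun_add_two _)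
  have hPφ := congrArg φ hP1
  simp only [map_mul, map_prod, map_sub, map_one, map_pow] at hPφ
  have hDφ : superDistinctGenFun (φ X) (20 * N) = φ (superDistinctGenFun X (20 * N)) := by
    simp [superDistinctGenFun, map_sum]
  have hφ : φ (superDistinctGenFun X (20 * N)) = φ P :=
    hDφ.symm.trans (left_inv_eq_right_inv hD ((mul_comm _ _).trans hPφ))
  have hdvd : X ^ N ∣ superDistinctGenFun (X : ℤ⟦X⟧) (20 * N) - P :=
    Ideal.mem_span_singleton.1 (Ideal.Quotient.eq.1 hφ)
  have hc := X_pow_dvd_iff.1 hdvd m h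
  rw [map_sub, hP m (by omega), sub_eq_zero, superDistinctGenFun, map_sum] at hc
  simp only [coeff_X_pow, sum_boole] at hc
  rw [← Nat.cast_inj (R := ℤ), ← hc]
  simp only [eq_comm]

/-- Splitting off ones and applying the Rogers–Ramanujan identity to each remaining size. -/
theorem numOnesPlusMinusOneModFive_eq_card {n N : ℕ} (h : n ≤ N) :
    numOnesPlusMinusOneModFive n = #{s ∈ superDistinctSets (20 * N) | ∑ a ∈ s, a < n} := by
  rw [numOnesPlusMinusOneModFive_eq_sum, card_eq_sum_card_fiberwise (t := range n)
    (f := fun s => ∑ a ∈ s, a) (fun s hs => by simpa using (mem_filter.1 hs).2)]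
  refine sum_congr rfl fun k hk => ?_
  rw [mem_range] at hk
  rw [← card_superDistinctSets_eq (hk.trans_le h), filter_filter]
  congr 1
  refine filter_congr fun s _ => ?_
  omega

/-! ### Deleting a part -/

/-- Deleting a chosen part `a` of a super-distinct partition of `n` is injective, since `a` is the
difference of the sizes. For `n ≥ 2` the one-part partition `n / 2` is not obtained: the deleted
part would be `n - n / 2`, which is too close to `n / 2`. -/
theorem sum_card_superDistinctSets_le (n L : ℕ) (hL : n ≤ L) :
    ∑ s ∈ superDistinctSets L with ∑ a ∈ s, a = n, #s ≤
        #{s ∈ superDistinctSets L | ∑ a ∈ s, a < n} ∧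
      (2 ≤ n → ∑ s ∈ superDistinctSets L with ∑ a ∈ s, a = n, #s <
        #{s ∈ superDistinctSets L | ∑ a ∈ s, a < n}) := by
  let S := ({s ∈ superDistinctSets L | ∑ a ∈ s, a = n}).sigma fun s => s
  let F : (_ : Finset ℕ) × ℕ → Finset ℕ := fun x => x.1.erase x.2
  have hmem : ∀ x ∈ S, x.1 ∈ superDistinctSets L ∧ ∑ a ∈ x.1, a = n ∧ x.2 ∈ x.1 := fun x hx => by
    simpa [S, and_assoc] using hx
  have hsum : ∀ x ∈ S, ∑ a ∈ F x, a + x.2 = n := fun x hx => by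
    obtain ⟨-, h2, h3⟩ := hmem x hx
    rw [← h2]
    exact sum_erase_add _ _ h3
  have hinj : Set.InjOn F S := by
    rintro ⟨s, a⟩ hx ⟨t, b⟩ hy h
    have h1 := hsum _ hx
    have h2 := hsum _ hy
    rw [h] at h1
    obtain rfl : a = b := by simp only at h1 h2; omega
    have : s = t := by
      have hs : a ∈ s := (hmem _ hx).2.2
      have ht : a ∈ t := (hmem _ hy).2.2
      rw [← insert_erase hs, ← insert_erase ht]
      exact congrArg (insert a) h
    rw [this]
  have hcard : ∑ s ∈ superDistinctSets L with ∑ a ∈ s, a = n, #s = #(S.image F) := by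
    rw [card_image_of_injOn hinj, card_sigma]
  have hsub : S.image F ⊆ {s ∈ superDistinctSets L | ∑ a ∈ s, a < n} := by
    intro t ht
    obtain ⟨x, hx, rfl⟩ := mem_image.1 ht
    obtain ⟨h1, -, h3⟩ := hmem x hx
    rw [mem_superDistinctSets] at h1
    rw [mem_filter, mem_superDistinctSets]
    refine ⟨⟨fun a ha => h1.1 a (mem_of_mem_erase ha), fun a ha hb => h1.2 a (mem_of_mem_erase ha)
      (mem_of_mem_erase hb)⟩, ?_⟩
    have := hsum x hx
    have := h1.1 _ h3
    omega
  rw [hcard]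
  refine ⟨card_le_card hsub, fun hn => card_lt_card ((ssubset_iff_of_subset hsub).2
    ⟨{n / 2}, ?_, ?_⟩)⟩
  · rw [mem_filter, mem_superDistinctSets]
    simp only [mem_singleton, forall_eq, sum_singleton]
    omega
  · intro ht
    obtain ⟨x, hx, hFx⟩ := mem_image.1 ht
    obtain ⟨h1, -, h3⟩ := hmem x hx
    have h4 := hsum x hx
    rw [hFx, sum_singleton] at h4
    have h5 : n / 2 ∈ x.1.erase x.2 := by
      change F x = _ at hFx
      change _ ∈ F x
      rw [hFx]; exact mem_singleton_self _
    have hne := ne_of_mem_erase h5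
    -- the deleted part has to be the successor of `n / 2`
    exact (mem_superDistinctSets.1 h1).2 _ (mem_of_mem_erase h5)
      ((show x.2 = n / 2 + 1 by omega) ▸ h3)

theorem corollary3p2 (n : ℕ) (hn : 1 ≤ n) :
    numPartsSuperDistinct n ≤ numOnesPlusMinusOneModFive n ∧
      (2 ≤ n → numPartsSuperDistinct n < numOnesPlusMinusOneModFive n) := by
  rw [numPartsSuperDistinct_eq (show n ≤ 20 * n by omega),
    numOnesPlusMinusOneModFive_eq_card le_rfl]
  exact sum_card_superDistinctSets_le n (20 * n) (by omega)
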